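/- Let $n\ge 0$ be an integer, $S^n$ the unit sphere of $\mathbb{R}^{n+1}$, and $\gamma:S^n\to\mathbb{R}_+=(0,\infty)$ a continuous function. Let $$\mathcal{W}_\gamma=\bigcap_{\theta\in S^n}\{x\in\mathbb{R}^{n+1}: x\cdot\theta\le\gamma(\theta)\}$$ be its Wulff shape, with radial function $\rho_{\mathcal{W}_\gamma}(\theta)=\max\{\lambda>0:\lambda\theta\in\mathcal{W}_\gamma\}$. The dual Wulff shape of $\mathcal{W}_\gamma$ is $\mathcal{DW}_\gamma=\mathcal{W}_{\overline{\gamma}}$, where $\overline{\gamma}(\theta)=1/\rho_{\mathcal{W}_\gamma}(-\theta)$, and $\mathcal{W}_\gamma$ is called self-dual if $\mathcal{W}_\gamma=\mathcal{DW}_\gamma$. Let $Id:\mathbb{R}^{n+1}\to\mathbb{R}^{n+1}\times\{1\}\subset\mathbb{R}^{n+2}$, $Id(x)=(x,1)$, let $N=(0,\dots,0,1)\in S^{n+1}$, and let $\alpha_N:\{Q\in S^{n+1}:N\cdot Q>0\}\to\mathbb{R}^{n+1}\times\{1\}$ be the central projection $\alpha_N(P_1,\dots,P_{n+2})=(P_1/P_{n+2},\dots,P_{n+1}/P_{n+2},1)$.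 The spherical Wulff shape of $\mathcal{W}_\gamma$ is $\widetilde{W}_\gamma=\alpha_N^{-1}(Id(\mathcal{W}_\gamma))\subset S^{n+1}$. A spherical convex body in $S^m$ is a closed set $K\subset S^m$ with nonempty interior relative to $S^m$ such that $\{\lambda u:\lambda>0,\ u\in K\}$ is convex in $\mathbb{R}^{m+1}$. With $|PQ|=\arccos(P\cdot Q)$ for $P,Q\in S^m$, a spherical convex body $K$ is of constant diameter $\tau$ if $\max\{|PQ|:P,Q\in K\}=\tau$ and for every point $P$ of the boundary of $K$ relative to $S^m$ there is a point $Q\in K$ with $|PQ|=\tau$. Then $\widetilde{W}_\gamma$ is a spherical convex body in $S^{n+1}$, and $\mathcal{W}_\gamma$ is a self-dual Wulff shape if and only if $\widetilde{W}_\gamma$ is of constant diameter $\pi/2$. -/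

import Mathlib

namespace SphericalWulff

/-- The unit sphere `S^n` of `ℝ^{n+1}`, as a type; it carries the subspace topology, so that
`frontier`, `interior`, `IsClosed` for subsets of `Sph n` are relative to `S^n`. -/
abbrev Sph (n : ℕ) : Type := Metric.sphere (0 : EuclideanSpace ℝ (Fin (n + 1))) 1

/-- The spherical distance `|PQ| = arccos (P · Q)`. -/
noncomputable def sdist {n : ℕ} (P Q : Sph n) : ℝ :=
  Real.arccos (inner ℝ (P : EuclideanSpace ℝ (Fin (n + 1))) (Q : EuclideanSpace ℝ (Fin (n + 1))))

/-- `K ⊆ S^n` is spherically convex if `{λ u : λ > 0, u ∈ K}` is convex in `ℝ^{n+1}`. -/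
def SphericallyConvex {n : ℕ} (K : Set (Sph n)) : Prop :=
  Convex ℝ {x : EuclideanSpace ℝ (Fin (n + 1)) |
    ∃ t : ℝ, 0 < t ∧ ∃ u ∈ K, x = t • (u : EuclideanSpace ℝ (Fin (n + 1)))}

/-- A spherical convex body: closed, spherically convex, with nonempty interior in `S^n`. -/
structure IsSphericalConvexBody {n : ℕ} (K : Set (Sph n)) : Prop where
  isClosed : IsClosed K
  convex : SphericallyConvex K
  interior_nonempty : (interior K).Nonempty

/-- The diameter of `K`, i.e. `max {|PQ| : P, Q ∈ K}`, exists and equals `τ`. -/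
def HasDiameter {n : ℕ} (K : Set (Sph n)) (τ : ℝ) : Prop :=
  IsGreatest {d : ℝ | ∃ P ∈ K, ∃ Q ∈ K, d = sdist P Q} τ

/-- The spherical convex body `K` is of constant diameter `τ`: its diameter is `τ`, and for every
boundary point `P` there is a point `Q` of `K` with `|PQ| = τ`. -/
structure IsOfConstantDiameter {n : ℕ} (K : Set (Sph n)) (τ : ℝ) : Prop where
  isBody : IsSphericalConvexBody K
  hasDiameter : HasDiameter K τ
  exists_of_mem_frontier : ∀ P ∈ frontier K, ∃ Q ∈ K, sdist P Q = τ

/-- The Wulff shape `W_γ`, the intersection of the half spaces `{x : x · θ ≤ γ θ}`, `θ ∈ S^n`. -/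
def wulffShape {n : ℕ} (γ : Sph n → ℝ) : Set (EuclideanSpace ℝ (Fin (n + 1))) :=
  ⋂ θ : Sph n, {x | inner ℝ x (θ : EuclideanSpace ℝ (Fin (n + 1))) ≤ γ θ}

/-- The radial function `ρ_W(θ) = max {λ > 0 : λ θ ∈ W}`; for Wulff shapes the supremum is a
maximum, see `isGreatest_radial`. -/
noncomputable def radial {n : ℕ} (W : Set (EuclideanSpace ℝ (Fin (n + 1)))) (θ : Sph n) : ℝ :=
  sSup {t : ℝ | 0 < t ∧ t • (θ : EuclideanSpace ℝ (Fin (n + 1))) ∈ W}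

/-- For continuous positive `γ` the maximum defining the radial function of `W_γ` is attained. -/
theorem isGreatest_radial {n : ℕ} {γ : Sph n → ℝ} (hc : Continuous γ) (hpos : ∀ θ, 0 < γ θ)
    (θ : Sph n) :
    IsGreatest {t : ℝ | 0 < t ∧ t • (θ : EuclideanSpace ℝ (Fin (n + 1))) ∈ wulffShape γ}
      (radial (wulffShape γ) θ) := by
  have hn : ∀ φ : Sph n, ‖(φ : EuclideanSpace ℝ (Fin (n + 1)))‖ = 1 := fun φ => by simp
  have hin : ∀ φ ψ : Sph n, inner ℝ (φ : EuclideanSpace ℝ (Fin (n + 1)))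
      (ψ : EuclideanSpace ℝ (Fin (n + 1))) ≤ 1 := fun φ ψ => by
    have h := real_inner_le_norm (φ : EuclideanSpace ℝ (Fin (n + 1)))
      (ψ : EuclideanSpace ℝ (Fin (n + 1)))
    rwa [hn, hn, one_mul] at h
  have hmem : ∀ t : ℝ, t • (θ : EuclideanSpace ℝ (Fin (n + 1))) ∈ wulffShape γ ↔
      ∀ φ : Sph n, t * inner ℝ (θ : EuclideanSpace ℝ (Fin (n + 1)))
        (φ : EuclideanSpace ℝ (Fin (n + 1))) ≤ γ φ := fun t => by
    simp [wulffShape, real_inner_smul_left]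
  obtain ⟨φ₀, -, hφ₀⟩ := isCompact_univ.exists_isMinOn ⟨θ, Set.mem_univ θ⟩ hc.continuousOn
  have hmin : ∀ φ, γ φ₀ ≤ γ φ := fun φ => hφ₀ (Set.mem_univ φ)
  have hne : γ φ₀ ∈
      {t : ℝ | 0 < t ∧ t • (θ : EuclideanSpace ℝ (Fin (n + 1))) ∈ wulffShape γ} := by
    refine ⟨hpos φ₀, (hmem _).2 fun φ => ?_⟩
    have h1 := hin θ φ
    have h2 := hmin φ
    have h3 := hpos φ₀
    nlinarith
  have hbdd : BddAbove
      {t : ℝ | 0 < t ∧ t • (θ : EuclideanSpace ℝ (Fin (n + 1))) ∈ wulffShape γ} := by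
    refine ⟨γ θ, fun t ht => ?_⟩
    have h := (hmem t).1 ht.2 θ
    rwa [real_inner_self_eq_norm_sq, hn, one_pow, mul_one] at h
  have hS : 0 < radial (wulffShape γ) θ := (hpos φ₀).trans_le (le_csSup hbdd hne)
  refine ⟨⟨hS, (hmem _).2 fun φ => ?_⟩, fun t ht => le_csSup hbdd ht⟩
  rcases le_or_gt (inner ℝ (θ : EuclideanSpace ℝ (Fin (n + 1)))
      (φ : EuclideanSpace ℝ (Fin (n + 1)))) 0 with h | h
  · exact (mul_nonpos_of_nonneg_of_nonpos hS.le h).trans (hpos φ).le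
  · rw [← le_div_iff₀ h]
    exact csSup_le ⟨_, hne⟩ fun t ht => (le_div_iff₀ h).2 ((hmem t).1 ht.2 φ)

/-- The function `γ̄(θ) = 1 / ρ_{W_γ}(-θ)`. -/
noncomputable def dualSupport {n : ℕ} (γ : Sph n → ℝ) (θ : Sph n) : ℝ :=
  1 / radial (wulffShape γ) (-θ)

/-- The dual Wulff shape `DW_γ = W_γ̄`. -/
noncomputable def dualWulffShape {n : ℕ} (γ : Sph n → ℝ) : Set (EuclideanSpace ℝ (Fin (n + 1))) :=
  wulffShape (dualSupport γ)

/-- `W_γ` is a self-dual Wulff shape if `W_γ = DW_γ`. -/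
def IsSelfDual {n : ℕ} (γ : Sph n → ℝ) : Prop :=
  wulffShape γ = dualWulffShape γ

/-- The map `Id : ℝ^{n+1} → ℝ^{n+1} × {1} ⊆ ℝ^{n+2}`, `x ↦ (x, 1)`. -/
noncomputable def idMap {n : ℕ} (x : EuclideanSpace ℝ (Fin (n + 1))) :
    EuclideanSpace ℝ (Fin (n + 2)) :=
  WithLp.toLp 2 (Fin.snoc (α := fun _ => ℝ) (fun i => x i) 1)

/-- The north pole `N = (0, …, 0, 1)` of `S^{n+1}`. -/
noncomputable def north (n : ℕ) : Sph (n + 1) :=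
  ⟨EuclideanSpace.single (Fin.last (n + 1)) 1, by simp⟩

/-- The open hemisphere of `S^{n+1}` centred at `N`, `{Q ∈ S^{n+1} : N · Q > 0}`. -/
def openNorthHemisphere (n : ℕ) : Set (Sph (n + 1)) :=
  {Q | 0 < inner ℝ (north n : EuclideanSpace ℝ (Fin (n + 2)))
    (Q : EuclideanSpace ℝ (Fin (n + 2)))}

/-- The central projection `α_N (P₁, …, P_{n+2}) = (P₁/P_{n+2}, …, P_{n+1}/P_{n+2}, 1)` relative
to `N`, defined on the open northern hemisphere. -/
noncomputable def centralProjection {n : ℕ} (P : openNorthHemisphere n) :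
    EuclideanSpace ℝ (Fin (n + 2)) :=
  WithLp.toLp 2 (Fin.snoc (α := fun _ => ℝ)
    (fun i : Fin (n + 1) => P.1.1 i.castSucc / P.1.1 (Fin.last (n + 1))) 1)

/-- The spherical Wulff shape `α_N⁻¹ (Id (W_γ))`, a subset of `S^{n+1}`. -/
noncomputable def sphericalWulffShape {n : ℕ} (γ : Sph n → ℝ) : Set (Sph (n + 1)) :=
  Subtype.val '' (centralProjection ⁻¹' (idMap '' wulffShape γ))

end SphericalWulff

namespace SphericalWulff

open Filter Topology

variable {n : ℕ}

local notation "𝔼" n => EuclideanSpace ℝ (Fin (n + 1))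

/-! The dual Wulff shape `DW` is the reflected polar body of `W`: it consists of the `x` with `x · w
≥ -1` for all `w ∈ W` (`mem_dualWulffShape`). Since `(x, 1) · (w, 1) = x · w + 1`, the inequality
says that the lifts of `x` and `w` to the sphere are at distance at most `π/2`, with distance `π/2`
exactly when `x · w = -1`. Hence `W ⊆ DW` means that the spherical shape has diameter at most `π/2`.

If `W = DW`, a boundary point `x` has some `w ∈ W` with `x · w = -1`: otherwise all these
inequalities are strict, and by compactness of `W` they persist near `x`, making `x` interior to
`DW` (`dualWulffShape_mem_nhds`). Conversely, under constant diameter, the boundary point on the ray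
through `x` has a partner `w` at distance `π/2`; a point further out on the ray violates `x · w ≥
-1`, so `DW ⊆ W`. -/

/-! ### Wulff shapes and the dual as a polar body -/

theorem mem_wulffShape {γ : Sph n → ℝ} {x : 𝔼 n} :
    x ∈ wulffShape γ ↔ ∀ θ : Sph n, inner ℝ x (θ : 𝔼 n) ≤ γ θ := by
  simp [wulffShape]

theorem isClosed_wulffShape (γ : Sph n → ℝ) : IsClosed (wulffShape γ) :=
  isClosed_iInter fun _ => isClosed_le (by fun_prop) continuous_const

theorem convex_wulffShape (γ : Sph n → ℝ) : Convex ℝ (wulffShape γ) := by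
  intro x hx y hy a b ha hb hab
  rw [mem_wulffShape] at *
  intro θ
  rw [inner_add_left, real_inner_smul_left, real_inner_smul_left]
  calc a * inner ℝ x (θ : 𝔼 n) + b * inner ℝ y (θ : 𝔼 n) ≤ a * γ θ + b * γ θ := by
        gcongr
        · exact hx θ
        · exact hy θ
    _ = γ θ := by rw [← add_mul, hab, one_mul]

/-- The nonzero vector `x` is a positive multiple of a point of the unit sphere. -/
theorem exists_smul_sphere {x : 𝔼 n} (hx : x ≠ 0) : ∃ θ : Sph n, x = ‖x‖ • (θ : 𝔼 n) := by
  have h : ‖x‖ ≠ 0 := norm_ne_zero_iff.2 hx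
  refine ⟨⟨‖x‖⁻¹ • x, by simp [norm_smul, h]⟩, ?_⟩
  simp [smul_smul, h]

theorem isCompact_wulffShape {γ : Sph n → ℝ} (hc : Continuous γ) : IsCompact (wulffShape γ) := by
  refine Metric.isCompact_of_isClosed_isBounded (isClosed_wulffShape γ) ?_
  obtain ⟨C, hC⟩ := (isCompact_univ (X := Sph n)).bddAbove_image hc.continuousOn
  refine isBounded_iff_forall_norm_le.2 ⟨max C 0, fun x hx => ?_⟩
  rcases eq_or_ne x 0 with rfl | hx0
  · simp
  obtain ⟨θ, hθ⟩ := exists_smul_sphere hx0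
  have h := mem_wulffShape.1 hx θ
  rw [hθ, real_inner_smul_left, real_inner_self_eq_norm_sq, norm_eq_of_mem_sphere] at h
  have h2 : γ θ ≤ C := hC ⟨θ, Set.mem_univ θ, rfl⟩
  exact le_max_of_le_left (by linarith)

theorem wulffShape_mem_nhds_zero {γ : Sph n → ℝ} (hc : Continuous γ) (hpos : ∀ θ, 0 < γ θ) :
    wulffShape γ ∈ 𝓝 (0 : 𝔼 n) := by
  have hne : Nonempty (Sph n) :=
    (NormedSpace.sphere_nonempty (E := EuclideanSpace ℝ (Fin (n + 1)))).2 zero_le_one |>.to_subtype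
  obtain ⟨φ, -, hφ⟩ := (isCompact_univ (X := Sph n)).exists_isMinOn
    Set.univ_nonempty hc.continuousOn
  refine mem_of_superset (Metric.ball_mem_nhds 0 (hpos φ)) fun x hx => mem_wulffShape.2 fun θ => ?_
  have h := real_inner_le_norm x (θ : 𝔼 n)
  rw [norm_eq_of_mem_sphere, mul_one] at h
  exact (h.trans (mem_ball_zero_iff.1 hx).le).trans (hφ (Set.mem_univ θ))

/-- On each ray only the farthest point `ρ(θ) θ` of `W` matters; its inequality is the constraint of
`γ̄` in direction `-θ`. -/
theorem mem_dualWulffShape {γ : Sph n → ℝ} (hc : Continuous γ) (hpos : ∀ θ, 0 < γ θ) {x : 𝔼 n} :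
    x ∈ dualWulffShape γ ↔ ∀ w ∈ wulffShape γ, -1 ≤ inner ℝ x w := by
  rw [dualWulffShape, mem_wulffShape]
  constructor
  · intro h w hw
    rcases eq_or_ne w 0 with rfl | hw0
    · simp
    obtain ⟨θ, hθ⟩ := exists_smul_sphere hw0
    have hr := isGreatest_radial hc hpos θ
    have hle : ‖w‖ ≤ radial (wulffShape γ) θ := hr.2 ⟨norm_pos_iff.2 hw0, hθ ▸ hw⟩
    have h1 := h (-θ)
    rw [dualSupport, neg_neg, le_div_iff₀ hr.1.1, coe_neg_sphere, inner_neg_right] at h1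
    rw [hθ, real_inner_smul_right]
    nlinarith [norm_nonneg w, hr.1.1]
  · intro h θ
    have hr := isGreatest_radial hc hpos (-θ)
    have h1 := h _ hr.1.2
    rw [coe_neg_sphere, real_inner_smul_right, inner_neg_right] at h1
    rw [dualSupport, le_div_iff₀ hr.1.1]
    linarith

/-! ### The lift to the sphere -/

theorem inner_idMap (x y : 𝔼 n) :
    inner ℝ (idMap x) (idMap y) = inner ℝ x y + 1 := by
  simp [idMap, PiLp.inner_apply, Fin.sum_univ_castSucc]

theorem idMap_last (x : 𝔼 n) : idMap x (Fin.last (n + 1)) = 1 := by simp [idMap]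

theorem idMap_castSucc (x : 𝔼 n) (i : Fin (n + 1)) : idMap x i.castSucc = x i := by simp [idMap]

theorem norm_idMap_pos (x : 𝔼 n) : 0 < ‖idMap x‖ := by
  refine norm_pos_iff.2 fun h => ?_
  simpa [h] using idMap_last x

theorem continuous_idMap : Continuous (idMap (n := n)) := by
  refine (PiLp.continuous_toLp 2 _).comp (continuous_pi fun i => ?_)
  refine Fin.lastCases ?_ (fun i => ?_) i
  · simpa using continuous_const
  · simpa using (by fun_prop : Continuous fun x : 𝔼 n => x i)

theorem smul_idMap_add_smul_idMap (x y : 𝔼 n) {a b : ℝ} (h : a + b = 1) :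
    a • idMap x + b • idMap y = idMap (a • x + b • y) := by
  ext i
  refine Fin.lastCases ?_ (fun i => ?_) i
  · simp [idMap_last, h]
  · simp [idMap_castSucc]

/-- The inverse of the central projection, `x ↦ (x, 1) / ‖(x, 1)‖`. -/
noncomputable def sphereLift (x : 𝔼 n) : Sph (n + 1) :=
  ⟨‖idMap x‖⁻¹ • idMap x, by simp [norm_smul, (norm_idMap_pos x).ne']⟩

theorem coe_sphereLift (x : 𝔼 n) : (sphereLift x : 𝔼 (n + 1)) = ‖idMap x‖⁻¹ • idMap x := rfl

theorem continuous_sphereLift : Continuous (sphereLift (n := n)) :=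
  Continuous.subtype_mk ((continuous_idMap.norm.inv₀ fun x => (norm_idMap_pos x).ne').smul
    continuous_idMap) _

theorem inner_sphereLift (x y : 𝔼 n) :
    inner ℝ (sphereLift x : 𝔼 (n + 1)) (sphereLift y : 𝔼 (n + 1)) =
      (‖idMap x‖⁻¹ * ‖idMap y‖⁻¹) * (inner ℝ x y + 1) := by
  rw [coe_sphereLift, coe_sphereLift, real_inner_smul_left, real_inner_smul_right, inner_idMap,
    mul_assoc]

theorem sdist_sphereLift_le {x y : 𝔼 n} :
    sdist (sphereLift x) (sphereLift y) ≤ Real.pi / 2 ↔ -1 ≤ inner ℝ x y := by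
  have h := mul_pos (inv_pos.2 (norm_idMap_pos x)) (inv_pos.2 (norm_idMap_pos y))
  rw [sdist, Real.arccos_le_pi_div_two, inner_sphereLift, mul_nonneg_iff_of_pos_left h]
  exact neg_le_iff_add_nonneg.symm

theorem sdist_sphereLift_eq {x y : 𝔼 n} :
    sdist (sphereLift x) (sphereLift y) = Real.pi / 2 ↔ inner ℝ x y = -1 := by
  have h := mul_pos (inv_pos.2 (norm_idMap_pos x)) (inv_pos.2 (norm_idMap_pos y))
  rw [sdist, Real.arccos_eq_pi_div_two, inner_sphereLift, mul_eq_zero, or_iff_right h.ne']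
  exact eq_neg_iff_add_eq_zero.symm

/-- The first `n + 1` affine coordinates of the central projection. -/
noncomputable def affineCoord (Q : Sph (n + 1)) : 𝔼 n :=
  WithLp.toLp 2 fun i => Q.1 i.castSucc / Q.1 (Fin.last (n + 1))

theorem mem_openNorthHemisphere {Q : Sph (n + 1)} :
    Q ∈ openNorthHemisphere n ↔ 0 < Q.1 (Fin.last (n + 1)) := by
  simp [openNorthHemisphere, north, EuclideanSpace.inner_single_left]

theorem sphereLift_last_pos (x : 𝔼 n) : 0 < (sphereLift x).1 (Fin.last (n + 1)) := by
  simp [coe_sphereLift, idMap_last, norm_idMap_pos x]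

theorem affineCoord_sphereLift (x : 𝔼 n) : affineCoord (sphereLift x) = x := by
  ext i
  have := (norm_idMap_pos x).ne'
  simp only [affineCoord, coe_sphereLift, PiLp.smul_apply, idMap_last, idMap_castSucc, smul_eq_mul]
  field_simp

theorem eq_smul_idMap_affineCoord {Q : Sph (n + 1)} (hQ : 0 < Q.1 (Fin.last (n + 1))) :
    (Q : 𝔼 (n + 1)) = Q.1 (Fin.last (n + 1)) • idMap (affineCoord Q) := by
  ext i
  refine Fin.lastCases ?_ (fun i => ?_) i
  · simp [idMap_last]
  · simp [idMap_castSucc, affineCoord, mul_div_cancel₀ _ hQ.ne']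

theorem sphereLift_affineCoord {Q : Sph (n + 1)} (hQ : 0 < Q.1 (Fin.last (n + 1))) :
    sphereLift (affineCoord Q) = Q := by
  have h := eq_smul_idMap_affineCoord hQ
  have hn : 1 = Q.1 (Fin.last (n + 1)) * ‖idMap (affineCoord Q)‖ := by
    have h1 := congrArg norm h
    rwa [norm_eq_of_mem_sphere, norm_smul, Real.norm_of_nonneg hQ.le] at h1
  refine Subtype.ext ?_
  rw [coe_sphereLift, ← eq_inv_of_mul_eq_one_left hn.symm, ← h]

theorem continuousAt_affineCoord {Q : Sph (n + 1)} (hQ : 0 < Q.1 (Fin.last (n + 1))) :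
    ContinuousAt affineCoord Q := by
  refine (PiLp.continuous_toLp 2 _).continuousAt.comp (continuousAt_pi.2 fun i => ?_)
  exact ContinuousAt.div (by fun_prop) (by fun_prop) hQ.ne'

theorem sphericalWulffShape_eq_image (γ : Sph n → ℝ) :
    sphericalWulffShape γ = sphereLift '' wulffShape γ := by
  ext Q
  constructor
  · rintro ⟨⟨P, hP⟩, ⟨x, hx, hxP⟩, rfl⟩
    refine ⟨x, hx, ?_⟩
    have h : affineCoord P = x := by
      ext i
      have h2 := congrArg (fun v : 𝔼 (n + 1) => v i.castSucc) hxP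
      simpa [idMap_castSucc, centralProjection, affineCoord] using h2.symm
    rw [← h]
    exact sphereLift_affineCoord (mem_openNorthHemisphere.1 hP)
  · rintro ⟨x, hx, rfl⟩
    refine ⟨⟨sphereLift x, mem_openNorthHemisphere.2 (sphereLift_last_pos x)⟩, ⟨x, hx, ?_⟩, rfl⟩
    have h := affineCoord_sphereLift x
    ext i
    refine Fin.lastCases ?_ (fun i => ?_) i
    · simp [idMap_last, centralProjection]
    · have h2 := congrArg (fun v : 𝔼 n => v i) h
      simpa [idMap_castSucc, centralProjection, affineCoord] using h2.symm

theorem sphereLift_mem_sphericalWulffShape {γ : Sph n → ℝ} {x : 𝔼 n} :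
    sphereLift x ∈ sphericalWulffShape γ ↔ x ∈ wulffShape γ := by
  rw [sphericalWulffShape_eq_image]
  exact (Function.LeftInverse.injective affineCoord_sphereLift).mem_set_image

/-- `sphereLift` and `affineCoord` are inverse and continuous between the affine space and the open
hemisphere, so interior and boundary points correspond. -/
theorem sphericalWulffShape_mem_nhds {γ : Sph n → ℝ} {x : 𝔼 n} :
    sphericalWulffShape γ ∈ 𝓝 (sphereLift x) ↔ wulffShape γ ∈ 𝓝 x := by
  constructor
  · intro h
    filter_upwards [continuous_sphereLift.continuousAt h] with y hy
    exact sphereLift_mem_sphericalWulffShape.1 hy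
  · intro h
    have hx := sphereLift_last_pos x
    have hlast : Continuous fun Q : Sph (n + 1) => Q.1 (Fin.last (n + 1)) := by fun_prop
    have h1 := continuousAt_affineCoord hx
    rw [ContinuousAt, affineCoord_sphereLift] at h1
    filter_upwards [h1 h, hlast.continuousAt.eventually_const_lt hx] with Q hQ hpos
    rw [← sphereLift_affineCoord hpos]
    exact sphereLift_mem_sphericalWulffShape.2 hQ

/-! ### The spherical Wulff shape is a convex body -/

theorem sphericallyConvex_sphericalWulffShape (γ : Sph n → ℝ) :
    SphericallyConvex (sphericalWulffShape γ) := by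
  rw [SphericallyConvex, sphericalWulffShape_eq_image]
  rintro _ ⟨t, ht, _, ⟨x, hx, rfl⟩, rfl⟩ _ ⟨s, hs, _, ⟨y, hy, rfl⟩, rfl⟩ a b ha hb hab
  rw [coe_sphereLift, coe_sphereLift]
  simp only [smul_smul]
  have hx0 := norm_idMap_pos x
  have hy0 := norm_idMap_pos y
  -- The combination is `p (x, 1) + q (y, 1)`; dividing by its height `p + q` gives a convex
  -- combination of `x` and `y`.
  set p := a * (t * ‖idMap x‖⁻¹) with hp
  set q := b * (s * ‖idMap y‖⁻¹) with hq
  have hp0 : 0 ≤ p := by positivity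
  have hq0 : 0 ≤ q := by positivity
  have hpq : 0 < p + q := by
    rcases ha.eq_or_lt with rfl | ha'
    · have : b = 1 := by linarith
      have : 0 < q := by rw [hq, this]; positivity
      linarith
    · have : 0 < p := by positivity
      linarith
  have h1 : p / (p + q) + q / (p + q) = 1 := by field_simp
  set z := (p / (p + q)) • x + (q / (p + q)) • y with hz
  have hzW : z ∈ wulffShape γ :=
    convex_wulffShape γ hx hy (by positivity) (by positivity) h1
  have hz0 := norm_idMap_pos z
  refine ⟨(p + q) * ‖idMap z‖, by positivity, _, ⟨z, hzW, rfl⟩, ?_⟩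
  rw [coe_sphereLift, smul_smul, mul_assoc, mul_inv_cancel₀ hz0.ne', mul_one, hz,
    ← smul_idMap_add_smul_idMap x y h1, smul_add, smul_smul, smul_smul,
    mul_div_cancel₀ _ hpq.ne', mul_div_cancel₀ _ hpq.ne']

theorem isSphericalConvexBody_sphericalWulffShape {γ : Sph n → ℝ} (hc : Continuous γ)
    (hpos : ∀ θ, 0 < γ θ) : IsSphericalConvexBody (sphericalWulffShape γ) where
  isClosed := by
    rw [sphericalWulffShape_eq_image]
    exact ((isCompact_wulffShape hc).image continuous_sphereLift).isClosed
  convex := sphericallyConvex_sphericalWulffShape γ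
  interior_nonempty := ⟨sphereLift 0, mem_interior_iff_mem_nhds.2
    (sphericalWulffShape_mem_nhds.2 (wulffShape_mem_nhds_zero hc hpos))⟩

/-! ### Boundary points and the equivalence -/

theorem dualWulffShape_mem_nhds {γ : Sph n → ℝ} (hc : Continuous γ) (hpos : ∀ θ, 0 < γ θ)
    {x : 𝔼 n} (hx : ∀ w ∈ wulffShape γ, -1 < inner ℝ x w) : dualWulffShape γ ∈ 𝓝 x := by
  have hopen : IsOpen {p : (𝔼 n) × (𝔼 n) | -1 < inner ℝ p.1 p.2} :=
    isOpen_lt continuous_const (by fun_prop)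
  have h := (isCompact_wulffShape hc).eventually_forall_of_forall_eventually (x₀ := x)
    (P := fun y w => -1 < inner ℝ y w) fun w hw => hopen.mem_nhds (hx w hw)
  filter_upwards [h] with y hy
  exact (mem_dualWulffShape hc hpos).2 fun w hw => (hy w hw).le

theorem wulffShape_notMem_nhds_radial_smul {γ : Sph n → ℝ} (hc : Continuous γ) (hpos : ∀ θ, 0 < γ θ)
    (θ : Sph n) : wulffShape γ ∉ 𝓝 (radial (wulffShape γ) θ • (θ : 𝔼 n)) := by
  intro h
  have hr := isGreatest_radial hc hpos θ
  have hcont : Continuous fun t : ℝ => t • (θ : 𝔼 n) := by fun_prop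
  have h1 : ∀ᶠ t in 𝓝 (radial (wulffShape γ) θ), t • (θ : 𝔼 n) ∈ wulffShape γ :=
    hcont.continuousAt h
  obtain ⟨t, ht, htlt⟩ := ((h1.filter_mono nhdsWithin_le_nhds).and
    (self_mem_nhdsWithin (s := Set.Ioi (radial (wulffShape γ) θ)))).exists
  exact (hr.2 ⟨hr.1.1.trans htlt, ht⟩).not_gt htlt

theorem IsSelfDual.exists_inner_eq {γ : Sph n → ℝ} (hc : Continuous γ) (hpos : ∀ θ, 0 < γ θ)
    (h : IsSelfDual γ) {x : 𝔼 n} (hx : x ∈ wulffShape γ) (hx' : wulffShape γ ∉ 𝓝 x) :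
    ∃ w ∈ wulffShape γ, inner ℝ x w = -1 := by
  by_contra! hne
  rw [h] at hx hx'
  exact hx' (dualWulffShape_mem_nhds hc hpos fun w hw =>
    ((mem_dualWulffShape hc hpos).1 hx w hw).lt_of_ne (hne w hw).symm)

theorem IsSelfDual.isOfConstantDiameter {γ : Sph n → ℝ} (hc : Continuous γ)
    (hpos : ∀ θ, 0 < γ θ) (h : IsSelfDual γ) :
    IsOfConstantDiameter (sphericalWulffShape γ) (Real.pi / 2) where
  isBody := isSphericalConvexBody_sphericalWulffShape hc hpos
  hasDiameter := by
    constructor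
    -- Any radial boundary point, with its partner, attains the diameter.
    · obtain ⟨θ, hθ⟩ := (NormedSpace.sphere_nonempty (E := EuclideanSpace ℝ (Fin (n + 1))) (x := 0)).2 zero_le_one
      have hr := (isGreatest_radial hc hpos ⟨θ, hθ⟩).1.2
      obtain ⟨w, hw, hxw⟩ := h.exists_inner_eq hc hpos hr (wulffShape_notMem_nhds_radial_smul hc hpos _)
      exact ⟨_, sphereLift_mem_sphericalWulffShape.2 hr, _,
        sphereLift_mem_sphericalWulffShape.2 hw, (sdist_sphereLift_eq.2 hxw).symm⟩
    · rintro _ ⟨P, hP, Q, hQ, rfl⟩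
      rw [sphericalWulffShape_eq_image] at hP hQ
      obtain ⟨x, hx, rfl⟩ := hP
      obtain ⟨w, hw, rfl⟩ := hQ
      rw [h] at hx
      exact sdist_sphereLift_le.2 ((mem_dualWulffShape hc hpos).1 hx w hw)
  exists_of_mem_frontier P hP := by
    have hPK := (isSphericalConvexBody_sphericalWulffShape hc hpos).isClosed.frontier_subset hP
    rw [sphericalWulffShape_eq_image] at hPK
    obtain ⟨x, hx, rfl⟩ := hPK
    have hx' : wulffShape γ ∉ 𝓝 x := fun hn =>
      hP.2 (mem_interior_iff_mem_nhds.2 (sphericalWulffShape_mem_nhds.2 hn))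
    obtain ⟨w, hw, hxw⟩ := h.exists_inner_eq hc hpos hx hx'
    exact ⟨_, sphereLift_mem_sphericalWulffShape.2 hw, sdist_sphereLift_eq.2 hxw⟩

theorem IsOfConstantDiameter.isSelfDual {γ : Sph n → ℝ} (hc : Continuous γ)
    (hpos : ∀ θ, 0 < γ θ)
    (h : IsOfConstantDiameter (sphericalWulffShape γ) (Real.pi / 2)) : IsSelfDual γ := by
  refine Set.Subset.antisymm (fun x hx => ?_) fun x hx => ?_
  · exact (mem_dualWulffShape hc hpos).2 fun w hw => sdist_sphereLift_le.1 <|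
      h.hasDiameter.2 ⟨_, sphereLift_mem_sphericalWulffShape.2 hx, _,
        sphereLift_mem_sphericalWulffShape.2 hw, rfl⟩
  · rw [mem_dualWulffShape hc hpos] at hx
    rcases eq_or_ne x 0 with rfl | hx0
    · exact mem_of_mem_nhds (wulffShape_mem_nhds_zero hc hpos)
    obtain ⟨θ, hθ⟩ := exists_smul_sphere hx0
    obtain ⟨⟨hr0, hrW⟩, -⟩ := isGreatest_radial hc hpos θ
    have hfr : sphereLift (radial (wulffShape γ) θ • (θ : 𝔼 n)) ∈
        frontier (sphericalWulffShape γ) :=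
      ⟨subset_closure (sphereLift_mem_sphericalWulffShape.2 hrW), fun hi =>
        wulffShape_notMem_nhds_radial_smul hc hpos θ
          (sphericalWulffShape_mem_nhds.1 (mem_interior_iff_mem_nhds.1 hi))⟩
    obtain ⟨Q, hQ, hPQ⟩ := h.exists_of_mem_frontier _ hfr
    rw [sphericalWulffShape_eq_image] at hQ
    obtain ⟨w, hw, rfl⟩ := hQ
    have h1 := sdist_sphereLift_eq.1 hPQ
    have h2 := hx w hw
    rw [hθ, real_inner_smul_left] at h2
    rw [real_inner_smul_left] at h1
    -- From `ρ (θ · w) = -1`, the product `θ · w` is negative, so `‖x‖ > ρ` would give `x · w < -1`.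
    have hle : ‖x‖ ≤ radial (wulffShape γ) θ := by
      by_contra! hlt
      nlinarith
    -- `x` lies on the segment from `0` to `ρ θ`, at parameter `‖x‖ / ρ`.
    have h3 := convex_wulffShape γ (mem_of_mem_nhds (wulffShape_mem_nhds_zero hc hpos)) hrW
      (sub_nonneg.2 ((div_le_one hr0).2 hle)) (div_nonneg (norm_nonneg x) hr0.le)
      (sub_add_cancel _ _)
    rwa [smul_zero, zero_add, smul_smul, div_mul_cancel₀ _ hr0.ne', ← hθ] at h3

end SphericalWulff

theorem mainTheorem4 (n : ℕ) (γ : SphericalWulff.Sph n → ℝ) (hγ : Continuous γ)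
    (hpos : ∀ θ : SphericalWulff.Sph n, 0 < γ θ) :
    SphericalWulff.IsSphericalConvexBody (SphericalWulff.sphericalWulffShape γ) ∧
    (SphericalWulff.IsSelfDual γ ↔
      SphericalWulff.IsOfConstantDiameter (SphericalWulff.sphericalWulffShape γ)
        (Real.pi / 2)) :=
  ⟨SphericalWulff.isSphericalConvexBody_sphericalWulffShape hγ hpos,
    fun h => h.isOfConstantDiameter hγ hpos, fun h => h.isSelfDual hγ hpos⟩
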